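/- **Setting.** A *tape* is an element of $\{0,1\}^{\mathbb N}$; $\mathcal U$ is the uniform (fair coin) distribution on tapes. Distributions $P,Q$ on the same measurable space are $(\varepsilon,\delta)$-indistinguishable, $P\approx_{\varepsilon,\delta}Q$, if $P(A)\le e^{\varepsilon}Q(A)+\delta$ and $Q(A)\le e^{\varepsilon}P(A)+\delta$ for every event $A$. *Executions.* A controller $C$ answers queries, which arrive on authenticated channels. In the real execution $C$ (coins $R$) interacts with an environment $E$ (coins $R_E$) and a data subject $Y$ (coins $R_Y$), both randomized and adaptive; all tapes are independent and uniform, and $C$ reads its tape only once. $Y$ has one channel to $C$, $E$ has all the others, $E$ and $Y$ may exchange messages freely, and one party at a time is active, beginning with $E$. Only $E$ can send the clock signal $\mathsf{tick}$. The execution ends once $C$ has processed the first $\mathsf{delete}$ message of $Y$; let $q_E$ be the sequence of queries of $E$ to $C$, and $\mathsf{state}$ the final state of $C$. If the execution never ends, $q_E$ is empty and $\mathsf{state}=\bot$. For a tape $R'$, the ideal execution replays $q_E$ to $C$ with coins $R'$ (regardless of the answers); $\mathsf{state}'$ is the final state of $C$ in it. *Deletion-as-control.* $C$ is $(\varepsilon,\delta)$-deletion-as-control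 compliant for a class of pairs $(E,Y)$ if there is a simulator (a randomized map) $\mathcal S$ such that, for all pairs in the class, with $R'\leftarrow\mathcal S(q_E,R,\mathsf{state})$: (i) $R'\approx_{\varepsilon,\delta}R$, and (ii) with probability at least $1-\delta$, $\mathsf{state}'=\mathsf{state}$ or $\mathsf{state}=\bot$. *Batch machine learning controller.* Let $M$ be a randomized training algorithm which maps a dataset (at most one record for every channel ID) to a model. $M$ is $(\varepsilon,\delta)$-differentially private if $M(D)\approx_{\varepsilon,\delta}M(D')$ whenever $D$ and $D'$ differ in the record of at most one ID. The controller $C_M$ has as its state a dataset $D$, stored as a list sorted by ID and empty at first, and an output $\mathsf{out}$, at first $\bot$. Before the first $\mathsf{tick}$ it applies each query (insert, set, get, delete) to the record in $D$ of the sending channel and answers $\bot$. At the first $\mathsf{tick}$ it sets $\mathsf{out}\leftarrow M(D)$, using its random tape, deletes $D$, and answers $\mathsf{out}$. Afterwards it answers $\mathsf{out}$ to every query and changes nothing; in particular it ignores deletion requests. **Corollary.** Let $\varepsilon\ge 0$, $0\le\delta<1$, and let $M$ be $(\varepsilon,\delta)$-differentially private. Then $C_M$ is $(\varepsilon,\delta)$-deletion-as-control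 compliant for the class of all $(E,Y)$ such that the controller's coins do not affect whether $Y$ ever requests deletion: for almost every choice of $(R_E,R_Y)$, the real execution with $C_M$ ends for almost every $R$, or it never ends for almost every $R$. (This class contains all $(E,Y)$ for which $Y$ requests deletion with probability $1$; when it does so may depend on everything that has happened.) -/

import Mathlib

open MeasureTheory ProbabilityTheory

noncomputable section

namespace DelControl

/-! ### Randomness and indistinguishability -/

/-- Finite bit strings. -/
abbrev Str := List Bool

/-- Finite strings carry the discrete σ-algebra. -/
instance instMeasurableSpaceStr : MeasurableSpace Str := ⊤

/-- A (countably infinite) random tape, with the product σ-algebra, i.e. the one generated by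
the sets of all tapes with a given finite prefix. -/
abbrev Tape := ℕ → Bool

/-- The uniform distribution on random tapes: independent fair coin flips. -/
def uniformTape : Measure Tape :=
  Measure.infinitePi fun _ : ℕ => (PMF.uniformOfFintype Bool).toMeasure

/-- `(ε, δ)`-indistinguishability of two distributions on the same measurable space. -/
def Indist {α : Type*} [MeasurableSpace α] (ε δ : ℝ) (P Q : Measure α) : Prop :=
  ∀ A : Set α, MeasurableSet A →
    P A ≤ ENNReal.ofReal (Real.exp ε) * Q A + ENNReal.ofReal δ ∧
    Q A ≤ ENNReal.ofReal (Real.exp ε) * P A + ENNReal.ofReal δ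

/-- What is left of a tape once its first `n` bits have been read; nothing but blanks is left
if the whole tape has been read (`n = ⊤`). -/
def dropTape (n : ℕ∞) (r : Tape) : Tape :=
  fun i => if n = ⊤ then false else r (n.toNat + i)

/-! ### Messages and parties -/

/-- Messages to a controller: the operations of a key-value store on the record of the sending
channel (`insert` sets the record to a default value), the deletion request `delete`, and the
clock signal `tick`. -/
inductive Msg where
  | insert
  | set (value : Str)
  | get
  | delete
  | tick

/-- A query, as the controller sees it: the ID of the (authenticated) channel on which the
message arrives, and the message. -/
structure Query where
  cid : Str
  msg : Msg

/-- A data controller, as an interactive machine that answers each query on the channel on which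
it has arrived. In each activation the machine sees its work tape (`State`), the query and the
unread part of its random tape, and produces its new state, its answer (`none` is `⊥`) and the
number of random bits that it has read. By `read_once` nothing depends on unread bits; bits that
have been read are not available in later activations, unless they are stored in the state. -/
structure Controller where
  State : Type
  countable_state : Countable State
  init : State
  act : State → Query → Tape → State × Option Str × ℕ∞
  measurable_act : ∀ s q b, MeasurableSet {r | act s q r = b}
  read_once : ∀ s q (r r' : Tape), (∀ i : ℕ, (i : ℕ∞) < (act s q r).2.2 → r' i = r i) →
    act s q r' = act s q r

/-- What activates the environment or the data subject: no message at all (at the start of the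
execution, or after some party has halted without sending anything), the notice that its own
last message could not be delivered, an answer of the controller, or a message of the other
one of the two parties. -/
inductive Incoming where
  | wake
  | fail
  | fromController (cid : Str) (answer : Option Str)
  | fromPeer (m : Str)

/-- How an activation of the environment or of the data subject ends: with a message to the
controller, with a message to the other one of the two parties, or without a message. -/
inductive Action where
  | toController (cid : Str) (m : Msg)
  | toPeer (m : Str)
  | halt

/-- A randomized, adaptive party: its next action as a function of its random tape and of
everything that it has received so far (most recent first). -/
structure Party where
  act : Tape → List Incoming → Action
  measurable_act : ∀ h a, MeasurableSet {r | act r h = a}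

/-! ### The real execution -/

/-- A snapshot of the real execution, between two activations. -/
structure Config (C : Controller) where
  /-- The controller's state. -/
  state : C.State
  /-- The unread part of the controller's random tape. -/
  tape : Tape
  /-- What the environment has received, most recent first. -/
  envView : List Incoming
  /-- What the data subject has received, most recent first. -/
  subjView : List Incoming
  /-- Whether the data subject (and not the environment) is the active party. -/
  subjActive : Bool
  /-- The queries of the environment to the controller, in order. -/
  envQueries : List Query
  /-- Whether the data subject's deletion request has been processed. -/
  ended : Bool

namespace Config

variable {C : Controller}

/-- The environment receives `i` and becomes active. -/
def toEnv (c : Config C) (i : Incoming) : Config C :=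
  { c with envView := i :: c.envView, subjActive := false }

/-- The data subject receives `i` and becomes active. -/
def toSubj (c : Config C) (i : Incoming) : Config C :=
  { c with subjView := i :: c.subjView, subjActive := true }

/-- The controller processes a query. -/
def query (c : Config C) (q : Query) : Config C :=
  { c with
    state := (C.act c.state q c.tape).1
    tape := dropTape (C.act c.state q c.tape).2.2 c.tape }

/-- The controller's answer to a query. -/
def answer (c : Config C) (q : Query) : Option Str := (C.act c.state q c.tape).2.1

end Config

open Classical in
/-- One activation of the environment `E` (with coins `rE`) or of the data subject `Y` (with
coins `rY`), together with the activation of the controller that it causes. The data subject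
owns the channel `y` to the controller, the environment owns all others; messages on a channel of
somebody else are not delivered, and neither is a `tick` of the data subject. -/
def realStep (C : Controller) (E Y : Party) (y : Str) (rE rY : Tape) (c : Config C) :
    Config C :=
  if c.ended then c
  else if c.subjActive then
    match Y.act rY c.subjView with
    | .toController cid m =>
        if cid ≠ y ∨ m = .tick then c.toSubj .fail
        else if m = .delete then { c.query (.mk y m) with ended := true }
        else (c.query (.mk y m)).toSubj (.fromController y (c.answer (.mk y m)))
    | .toPeer m => c.toEnv (.fromPeer m)
    | .halt => c.toEnv .wake
  else
    match E.act rE c.envView with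
    | .toController cid m =>
        if cid = y then c.toEnv .fail
        else
          Config.toEnv { c.query ⟨cid, m⟩ with envQueries := c.envQueries ++ [⟨cid, m⟩] }
            (.fromController cid (c.answer ⟨cid, m⟩))
    | .toPeer m => c.toSubj (.fromPeer m)
    | .halt => c.toEnv .wake

/-- The start of the real execution: the environment is active. -/
def realInit (C : Controller) (R : Tape) : Config C where
  state := C.init
  tape := R
  envView := [.wake]
  subjView := []
  subjActive := false
  envQueries := []
  ended := false

/-- The real execution after `n` activations of the environment or the data subject. -/
def realConfig (C : Controller) (E Y : Party) (y : Str) (rE rY R : Tape) (n : ℕ) : Config C :=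
  (realStep C E Y y rE rY)^[n] (realInit C R)

/-- The real execution ends, i.e. the data subject requests deletion at some time. -/
def Terminates (C : Controller) (E Y : Party) (y : Str) (rE rY R : Tape) : Prop :=
  ∃ n, (realConfig C E Y y rE rY R n).ended = true

open Classical in
/-- The result of the real execution: the environment's queries to the controller and the
controller's final state. If the execution never ends, there are no queries and the state
is `⊥` (`none`). -/
def realResult (C : Controller) (E Y : Party) (y : Str) (rE rY R : Tape) :
    List Query × Option C.State :=
  if h : ∃ n, (realConfig C E Y y rE rY R n).ended = true then
    ((realConfig C E Y y rE rY R (Nat.find h)).envQueries,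
      some (realConfig C E Y y rE rY R (Nat.find h)).state)
  else ([], none)

/-! ### The ideal execution -/

/-- The final state of a controller that starts in state `s` with random tape `r` and to which a
list of queries is replayed, whatever its answers are. -/
def replay (C : Controller) (s : C.State) (r : Tape) : List Query → C.State
  | [] => s
  | q :: qs => replay C (C.act s q r).1 (dropTape (C.act s q r).2.2 r) qs

/-- The controller's final state in the ideal execution, with random tape `R'`. -/
def idealState (C : Controller) (qs : List Query) (R' : Tape) : C.State :=
  replay C C.init R' qs

/-! ### Deletion-as-control -/

/-- A simulator: given the environment's queries, the real-world state (or `⊥`) and the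
real-world randomness of the controller, it samples ideal-world randomness. -/
structure Simulator (C : Controller) where
  sample : List Query → Option C.State → Kernel Tape Tape
  markov : ∀ qs s, IsMarkovKernel (sample qs s)

/-- The coins `(rE, rY, R)` of the environment, the data subject and the controller. -/
abbrev Coins := Tape × Tape × Tape

/-- All parties have independent uniform random tapes. -/
def coinsLaw : Measure Coins := uniformTape.prod (uniformTape.prod uniformTape)

/-- The joint law of the coins of the real execution and the simulated randomness `R'`. -/
def experiment (C : Controller) (S : Simulator C) (E Y : Party) (y : Str) :
    Measure (Coins × Tape) :=
  coinsLaw.bind fun ω =>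
    (S.sample (realResult C E Y y ω.1 ω.2.1 ω.2.2).1 (realResult C E Y y ω.1 ω.2.1 ω.2.2).2
      ω.2.2).map (Prod.mk ω)

/-- `(ε, δ)`-deletion-as-control compliance of the controller `C`, for those environments `E` and
data subjects `Y` (with channel `y`) for which `P y E Y` holds: some simulator makes, for all of
them, the simulated randomness `(ε, δ)`-indistinguishable from uniform randomness, and the ideal
state equal to the real one (unless the latter is `⊥`) with probability at least `1 - δ`. -/
def DeletionAsControlFor (ε δ : ℝ) (C : Controller) (P : Str → Party → Party → Prop) : Prop :=
  ∃ S : Simulator C, ∀ (y : Str) (E Y : Party), P y E Y →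
    Indist ε δ ((experiment C S E Y y).map Prod.snd) uniformTape ∧
    ENNReal.ofReal (1 - δ) ≤ experiment C S E Y y
      {p | (realResult C E Y y p.1.1 p.1.2.1 p.1.2.2).2 =
            some (idealState C (realResult C E Y y p.1.1 p.1.2.1 p.1.2.2).1 p.2) ∨
          (realResult C E Y y p.1.1 p.1.2.1 p.1.2.2).2 = none}

/-- Whether the data subject ever requests deletion is not a matter of the controller's coins:
once the coins of the environment and the data subject are fixed, the real execution ends almost
surely or never ends almost surely. -/
def TerminationUnaffected (C : Controller) (y : Str) (E Y : Party) : Prop :=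
  ∀ᵐ p : Tape × Tape ∂(uniformTape.prod uniformTape),
    (∀ᵐ R ∂uniformTape, Terminates C E Y y p.1 p.2 R) ∨
    (∀ᵐ R ∂uniformTape, ¬ Terminates C E Y y p.1 p.2 R)

/-! ### Dictionaries -/

/-- Values of records; `⊤` is the default value that an `insert` stores. -/
abbrev Val := WithTop Str

/-- Dictionaries, stored as association lists that are strictly sorted by key. The memory
representation is determined by the logical contents, so that it is history independent. -/
def Dict := {l : List (Str × Val) // l.Pairwise fun a b => a.1 < b.1}

namespace Dict

/-- The empty dictionary. -/
def empty : Dict := ⟨[], List.Pairwise.nil⟩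

/-- The value stored for `k`, if there is one. -/
def lookup (d : Dict) (k : Str) : Option Val := d.1.lookup k

/-- Remove the record of `k`, if there is one. -/
def erase (d : Dict) (k : Str) : Dict := ⟨d.1.filter fun a => a.1 ≠ k, d.2.filter _⟩

/-- Store the value `v` for `k`, replacing the former value if there is one. -/
def set (d : Dict) (k : Str) (v : Val) : Dict :=
  ⟨(d.1.filter fun a => a.1 < k) ++ (k, v) :: d.1.filter fun a => k < a.1, by
    refine List.pairwise_append.2 ⟨d.2.filter _, List.pairwise_cons.2 ⟨?_, d.2.filter _⟩, ?_⟩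
    · intro a ha
      simpa using (List.mem_filter.1 ha).2
    · intro a ha b hb
      have h1 : a.1 < k := by simpa using (List.mem_filter.1 ha).2
      rcases List.mem_cons.1 hb with rfl | hb
      · exact h1
      · have h2 : k < b.1 := by simpa using (List.mem_filter.1 hb).2
        exact h1.trans h2⟩

/-- The effect of a query on the data: it concerns the record of the sending channel only. -/
def update (d : Dict) (q : Query) : Dict :=
  match q.msg with
  | .insert => d.set q.cid ⊤
  | .set v => d.set q.cid v
  | .get => d
  | .delete => d.erase q.cid
  | .tick => d

/-- Two datasets are neighbors if they differ in the record of at most one user. -/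
def Neighbors (d d' : Dict) : Prop := ∃ k, ∀ j, j ≠ k → d.lookup j = d'.lookup j

end Dict

/-! ### Differentially private training and the batch controller -/

/-- A randomized training algorithm: the model, as a function of the dataset and random bits. -/
structure Mechanism where
  train : Dict → Tape → Str
  measurable_train : ∀ d, Measurable (train d)

/-- `(ε, δ)`-differential privacy. -/
def Mechanism.IsDP (M : Mechanism) (ε δ : ℝ) : Prop :=
  ∀ d d' : Dict, d.Neighbors d' →
    Indist ε δ (uniformTape.map (M.train d)) (uniformTape.map (M.train d'))

/-- The batch machine learning controller. Its state consists of the dataset and the published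
model (`none` before training). Until the first `tick` it only maintains the dataset, answering
`⊥`. At the first `tick` it trains the model with its random tape, deletes the dataset and
publishes the model. Afterwards it answers every query with the model and changes nothing; in
particular it ignores deletion requests. -/
def batchController (M : Mechanism) : Controller where
  State := Dict × Option Str
  countable_state := by unfold Dict; infer_instance
  init := (Dict.empty, none)
  act s q r :=
    match s.2, q.msg with
    | some model, _ => (s, some model, 0)
    | none, .tick => ((Dict.empty, some (M.train s.1 r)), some (M.train s.1 r), ⊤)
    | none, _ => ((s.1.update q, none), none, 0)
  measurable_act := by
    rintro ⟨d, _ | z⟩ ⟨c, m⟩ b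
    · cases m
      case tick =>
        exact M.measurable_train d
          (t := {z | ((Dict.empty, some z), some z, (⊤ : ℕ∞)) = b}) trivial
      all_goals exact MeasurableSet.const (_ = b)
    · exact MeasurableSet.const (((d, some z), some z, (0 : ℕ∞)) = b)
  read_once := by
    rintro ⟨d, _ | z⟩ ⟨c, m⟩ r r' h
    · cases m
      case tick =>
        have : r' = r := funext fun i => h i (ENat.natCast_lt_top i)
        rw [this]
      all_goals rfl
    · rfl

end DelControl

end

noncomputable section

namespace DelControl

/-! ### Measurability of the real execution -/

/-! Fix the coins of the environment and the data subject. Before the first `tick` the controller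
answers `⊥` and reads no coins, so the run up to that point is the same for every tape `R`. Hence
either no training ever happens, or the model is `M.train d R` for a dataset `d` independent of `R`
(`untrained_or_trained`). The environment's queries alone produce `d.erase y`, because queries of
`y` disappear under `erase y` and all others commute with it.

If there is no model, the simulator keeps `R`; after a processed deletion the real dataset has no
record of `y`, so it is the ideal one. If there is a model `z`, the simulator draws `R'` from the
uniform law conditioned on `M.train (d.erase y) R' = z`. Then `R'` is a mixture of these posteriors
with `z` distributed as `M(d)`, while mixing the same posteriors over `M(d.erase y)` gives exactly
the uniform law (`Mechanism.lintegral_posterior`). Privacy makes the two mixing laws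
indistinguishable, and this passes to the mixtures (`lintegral_le_of_forall_measure_le`). The ideal
model can differ from `z` only if `z` has probability zero under `M(d.erase y)`; such models form a
null set for `M(d.erase y)`, hence have probability at most `δ` under `M(d)`.

The condition on termination ensures that, for almost all fixed coins of the two parties, the
simulator either keeps almost every `R` or resamples almost every `R`. The resulting bounds are then
averaged over those coins. -/

theorem measurable_dispatch {X ι Z : Type*} [MeasurableSpace X] [MeasurableSpace Z] [Countable ι]
    {g : X → ι} (hg : ∀ i, MeasurableSet {x | g x = i}) {F : ι → X → Z}
    (hF : ∀ i, Measurable (F i)) : Measurable fun x => F (g x) x := by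
  intro t ht
  have : (fun x => F (g x) x) ⁻¹' t = ⋃ i, {x | g x = i} ∩ F i ⁻¹' t := by
    ext x
    simp
  rw [this]
  exact MeasurableSet.iUnion fun i => (hg i).inter (hF i ht)

/-- Only the fibres of `g` matter, so `ι` needs no σ-algebra. Actions, answers and states range over
countable types, which reduces measurability of the execution to one outcome at a time. -/
theorem measurableSet_dispatch {X ι : Type*} [MeasurableSpace X] [Countable ι]
    {g : X → ι} (hg : ∀ i, MeasurableSet {x | g x = i}) {P : ι → X → Prop}
    (hP : ∀ i, MeasurableSet {x | P i x}) : MeasurableSet {x | P (g x) x} := by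
  have : {x | P (g x) x} = ⋃ i, {x | g x = i} ∩ {x | P i x} := by
    ext x
    simp
  rw [this]
  exact MeasurableSet.iUnion fun i => (hg i).inter (hP i)

instance instCountableMsg : Countable Msg := by
  let f : Msg → Option (Option (Option (Option Str))) := fun
    | .insert => none
    | .set v => some (some (some (some v)))
    | .get => some none
    | .delete => some (some none)
    | .tick => some (some (some none))
  refine Function.Injective.countable (f := f) fun a b h => ?_
  cases a <;> cases b <;> simp_all [f]

instance instCountableQuery : Countable Query :=
  Function.Injective.countable (f := fun q : Query => (q.cid, q.msg)) fun a b h => by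
    cases a; cases b; simp_all

instance instCountableIncoming : Countable Incoming := by
  let f : Incoming → Option (Option (Str × Option Str ⊕ Str)) := fun
    | .wake => none
    | .fail => some none
    | .fromController c a => some (some (.inl (c, a)))
    | .fromPeer m => some (some (.inr m))
  refine Function.Injective.countable (f := f) fun a b h => ?_
  cases a <;> cases b <;> simp_all [f]

instance instCountableAction : Countable Action := by
  let f : Action → Option (Str × Msg ⊕ Str) := fun
    | .toController c a => some (.inl (c, a))
    | .toPeer m => some (.inr m)
    | .halt => none
  refine Function.Injective.countable (f := f) fun a b h => ?_
  cases a <;> cases b <;> simp_all [f]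

theorem measurable_dropTape (n : ℕ∞) : Measurable (dropTape n) := by
  unfold dropTape
  split_ifs
  · exact measurable_const
  · exact measurable_pi_lambda _ fun i => measurable_pi_apply _

/-! ### Measurable structure on snapshots -/

namespace Config

variable {C : Controller}

instance instCountableState : Countable C.State := C.countable_state

/-- Everything in a snapshot except for the controller's tape. -/
abbrev Discrete (C : Controller) : Type :=
  C.State × List Incoming × List Incoming × Bool × List Query × Bool

/-- The part of a snapshot that takes countably many values. -/
def discrete (c : Config C) : Discrete C :=
  (c.state, c.envView, c.subjView, c.subjActive, c.envQueries, c.ended)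

/-- Snapshots carry the σ-algebra generated by their discrete part and by the tape. -/
instance instMeasurableSpace : MeasurableSpace (Config C) :=
  MeasurableSpace.comap discrete ⊤ ⊔ MeasurableSpace.comap tape inferInstance

theorem measurable_tape : Measurable (tape : Config C → Tape) :=
  Measurable.mono (comap_measurable _) le_sup_right le_rfl

theorem measurableSet_discrete (s : Set (Discrete C)) :
    MeasurableSet {c : Config C | c.discrete ∈ s} :=
  (le_sup_left : MeasurableSpace.comap discrete ⊤ ≤ (inferInstance : MeasurableSpace (Config C)))
    _ ⟨s, trivial, rfl⟩

theorem measurable_of_discrete_tape {X : Type*} [MeasurableSpace X] {f : X → Config C}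
    (hd : ∀ b, MeasurableSet {x | (f x).discrete = b}) (ht : Measurable fun x => (f x).tape) :
    Measurable f := by
  refine measurable_iff_comap_le.2 ?_
  rw [instMeasurableSpace, MeasurableSpace.comap_sup, MeasurableSpace.comap_comp,
    MeasurableSpace.comap_comp]
  refine sup_le ?_ ht.comap_le
  rintro _ ⟨s, -, rfl⟩
  exact measurableSet_dispatch (P := fun b _ => b ∈ s) hd fun b => MeasurableSet.const (b ∈ s)

theorem measurable_of_discrete_map {f : Config C → Config C} (u : Discrete C → Discrete C)
    (hd : ∀ c, (f c).discrete = u c.discrete) (ht : ∀ c, (f c).tape = c.tape) :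
    Measurable f := by
  refine measurable_of_discrete_tape (fun b => ?_) ?_
  · simp_rw [hd]
    exact measurableSet_discrete {a | u a = b}
  · simp_rw [ht]
    exact measurable_tape

theorem measurable_toEnv (i : Incoming) : Measurable fun c : Config C => c.toEnv i :=
  measurable_of_discrete_map
    (fun a => (a.1, i :: a.2.1, a.2.2.1, false, a.2.2.2.2)) (fun _ => rfl) fun _ => rfl

theorem measurable_toSubj (i : Incoming) : Measurable fun c : Config C => c.toSubj i :=
  measurable_of_discrete_map
    (fun a => (a.1, a.2.1, i :: a.2.2.1, true, a.2.2.2.2)) (fun _ => rfl) fun _ => rfl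

theorem measurable_appendQuery (q : Query) :
    Measurable fun c : Config C => { c with envQueries := c.envQueries ++ [q] } :=
  measurable_of_discrete_map
    (fun a => (a.1, a.2.1, a.2.2.1, a.2.2.2.1, a.2.2.2.2.1 ++ [q], a.2.2.2.2.2))
    (fun _ => rfl) fun _ => rfl

theorem measurable_setEnded : Measurable fun c : Config C => { c with ended := true } :=
  measurable_of_discrete_map
    (fun a => (a.1, a.2.1, a.2.2.1, a.2.2.2.1, a.2.2.2.2.1, true)) (fun _ => rfl) fun _ => rfl

theorem measurableSet_act (q : Query) (b : C.State × Option Str × ℕ∞) :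
    MeasurableSet {c : Config C | C.act c.state q c.tape = b} :=
  measurableSet_dispatch (g := fun c : Config C => c.state)
    (P := fun s c => C.act s q c.tape = b)
    (fun s => measurableSet_discrete {a | a.1 = s})
    fun s => measurable_tape (C.measurable_act s q b)

/-- Once the controller's output is fixed, the new state is constant and the tape is shifted by a
fixed amount; there are countably many outputs. -/
theorem measurable_query (q : Query) : Measurable fun c : Config C => c.query q := by
  refine measurable_dispatch (g := fun c : Config C => C.act c.state q c.tape)
    (F := fun b c => ({ c with state := b.1, tape := dropTape b.2.2 c.tape } : Config C))
    (measurableSet_act q) fun b => ?_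
  refine measurable_of_discrete_tape (fun d => ?_) ?_
  · exact measurableSet_discrete {a | (b.1, a.2) = d}
  · exact (measurable_dropTape _).comp measurable_tape

theorem measurableSet_answer (q : Query) (a : Option Str) :
    MeasurableSet {c : Config C | c.answer q = a} :=
  measurableSet_dispatch (P := fun b _ => b.2.1 = a) (measurableSet_act q)
    fun b => MeasurableSet.const (b.2.1 = a)

end Config

theorem Party.measurableSet_act {X V : Type*} [MeasurableSpace X] [Countable V] (P : Party)
    {r : X → Tape} (hr : Measurable r) {h : X → V} (hh : ∀ v, MeasurableSet {x | h x = v})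
    (view : V → List Incoming) (a : Action) :
    MeasurableSet {x | P.act (r x) (view (h x)) = a} :=
  measurableSet_dispatch (P := fun v x => P.act (r x) (view v) = a) hh
    fun v => hr (P.measurable_act (view v) a)

open Classical Config in
theorem measurable_realStep (C : Controller) (E Y : Party) (y : Str) :
    Measurable fun x : (Tape × Tape) × Config C => realStep C E Y y x.1.1 x.1.2 x.2 := by
  have hd : ∀ b : Discrete C, MeasurableSet {x : (Tape × Tape) × Config C | x.2.discrete = b} :=
    fun b => measurable_snd (measurableSet_discrete {b})
  have hY := fun a => Y.measurableSet_act
    (measurable_snd.comp (measurable_fst (α := Tape × Tape) (β := Config C))) hd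
    (fun b => b.2.2.1) a
  have hE := fun a => E.measurableSet_act
    (measurable_fst.comp (measurable_fst (α := Tape × Tape) (β := Config C))) hd
    (fun b => b.2.1) a
  unfold realStep
  refine Measurable.ite (measurable_snd (measurableSet_discrete {b | b.2.2.2.2.2 = true}))
    measurable_snd (Measurable.ite
      (measurable_snd (measurableSet_discrete {b | b.2.2.2.1 = true})) ?_ ?_)
  -- The action becomes a countable index; inside a query, the controller's answer is later treated
  -- in the same way.
  · refine measurable_dispatch
      (F := fun (a : Action) (x : (Tape × Tape) × Config C) => show Config C from match a with
      | .toController cid m =>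
          if cid ≠ y ∨ m = Msg.tick then x.2.toSubj .fail
          else if m = Msg.delete then { x.2.query (Query.mk y m) with ended := true }
          else (x.2.query (Query.mk y m)).toSubj (.fromController y (x.2.answer (Query.mk y m)))
      | .toPeer m => x.2.toEnv (.fromPeer m)
      | .halt => x.2.toEnv .wake) hY fun a => ?_
    rcases a with ⟨cid, m⟩ | m | _
    · dsimp only
      split_ifs
      · exact (measurable_toSubj _).comp measurable_snd
      · exact measurable_setEnded.comp ((measurable_query _).comp measurable_snd)
      · exact measurable_dispatch
          (F := fun (a : Option Str) (x : (Tape × Tape) × Config C) =>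
            (x.2.query (Query.mk y m)).toSubj (.fromController y a))
          (fun a => measurable_snd (measurableSet_answer (Query.mk y m) a))
          fun a => (measurable_toSubj _).comp ((measurable_query _).comp measurable_snd)
    · exact (measurable_toEnv _).comp measurable_snd
    · exact (measurable_toEnv _).comp measurable_snd
  · refine measurable_dispatch
      (F := fun (a : Action) (x : (Tape × Tape) × Config C) => show Config C from match a with
      | .toController cid m =>
          if cid = y then x.2.toEnv .fail
          else
            Config.toEnv
              { x.2.query (Query.mk cid m) with
                envQueries := x.2.envQueries ++ [Query.mk cid m] }
              (.fromController cid (x.2.answer (Query.mk cid m)))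
      | .toPeer m => x.2.toSubj (.fromPeer m)
      | .halt => x.2.toEnv .wake) hE fun a => ?_
    rcases a with ⟨cid, m⟩ | m | _
    · dsimp only
      split_ifs
      · exact (measurable_toEnv _).comp measurable_snd
      · exact measurable_dispatch
          (F := fun (a : Option Str) (x : (Tape × Tape) × Config C) => Config.toEnv
            { x.2.query (Query.mk cid m) with envQueries := x.2.envQueries ++ [Query.mk cid m] }
            (.fromController cid a))
          (fun a => measurable_snd (measurableSet_answer (Query.mk cid m) a))
          fun a => (measurable_toEnv _).comp
            ((measurable_appendQuery _).comp ((measurable_query _).comp measurable_snd))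
    · exact (measurable_toSubj _).comp measurable_snd
    · exact (measurable_toEnv _).comp measurable_snd

theorem realConfig_succ (C : Controller) (E Y : Party) (y : Str) (rE rY R : Tape) (n : ℕ) :
    realConfig C E Y y rE rY R (n + 1) =
      realStep C E Y y rE rY (realConfig C E Y y rE rY R n) :=
  Function.iterate_succ_apply' _ _ _

theorem measurable_realConfig (C : Controller) (E Y : Party) (y : Str) (n : ℕ) :
    Measurable fun ω : Coins => realConfig C E Y y ω.1 ω.2.1 ω.2.2 n := by
  induction n with
  | zero =>
    refine Config.measurable_of_discrete_tape (fun b => ?_) measurable_snd.snd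
    exact MeasurableSet.const ((C.init, [Incoming.wake], [], false, [], false) = b)
  | succ n ih =>
    simp_rw [realConfig_succ]
    exact (measurable_realStep C E Y y).comp
      ((measurable_fst.prodMk measurable_snd.fst).prodMk ih)

theorem realConfig_add_of_ended {C : Controller} {E Y : Party} {y : Str} {rE rY R : Tape} {n : ℕ}
    (h : (realConfig C E Y y rE rY R n).ended = true) (k : ℕ) :
    realConfig C E Y y rE rY R (n + k) = realConfig C E Y y rE rY R n := by
  induction k with
  | zero => rfl
  | succ k ih => rw [← add_assoc, realConfig_succ, ih, realStep, if_pos h]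

/-- Snapshots are frozen once the execution has ended, so any ending time may replace the first one.
-/
theorem realResult_of_ended {C : Controller} {E Y : Party} {y : Str} {rE rY R : Tape} {n : ℕ}
    (h : (realConfig C E Y y rE rY R n).ended = true) :
    realResult C E Y y rE rY R = ((realConfig C E Y y rE rY R n).envQueries,
      some (realConfig C E Y y rE rY R n).state) := by
  classical
  have hex : ∃ n, (realConfig C E Y y rE rY R n).ended = true := ⟨n, h⟩
  obtain ⟨k, hk⟩ := Nat.exists_eq_add_of_le (Nat.find_min' hex h)
  have := realConfig_add_of_ended (Nat.find_spec hex) k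
  rw [realResult, dif_pos hex, hk, this]

theorem realResult_of_not_terminates {C : Controller} {E Y : Party} {y : Str} {rE rY R : Tape}
    (h : ¬ Terminates C E Y y rE rY R) : realResult C E Y y rE rY R = ([], none) :=
  dif_neg h

theorem measurableSet_realResult (C : Controller) (E Y : Party) (y : Str)
    (b : List Query × Option C.State) :
    MeasurableSet {ω : Coins | realResult C E Y y ω.1 ω.2.1 ω.2.2 = b} := by
  have hd : ∀ n (s : Set (Config.Discrete C)),
      MeasurableSet {ω : Coins | (realConfig C E Y y ω.1 ω.2.1 ω.2.2 n).discrete ∈ s} :=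
    fun n s => measurable_realConfig C E Y y n (Config.measurableSet_discrete s)
  have : {ω : Coins | realResult C E Y y ω.1 ω.2.1 ω.2.2 = b} =
      (⋃ n, {ω : Coins | (realConfig C E Y y ω.1 ω.2.1 ω.2.2 n).discrete ∈
        {a : Config.Discrete C | a.2.2.2.2.2 = true ∧ (a.2.2.2.2.1, some a.1) = b}}) ∪
      (⋂ n, {ω : Coins | (realConfig C E Y y ω.1 ω.2.1 ω.2.2 n).discrete ∈
        {a : Config.Discrete C | a.2.2.2.2.2 ≠ true ∧ ([], none) = b}}) := by
    ext ω
    simp only [Set.mem_ofPred_eq, Set.mem_union, Set.mem_iUnion, Set.mem_iInter, Config.discrete]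
    by_cases h : Terminates C E Y y ω.1 ω.2.1 ω.2.2
    · obtain ⟨n, hn⟩ := h
      constructor
      · intro hb
        exact .inl ⟨n, hn, (realResult_of_ended hn).symm.trans hb⟩
      · rintro (⟨m, hm, hb⟩ | h')
        · exact (realResult_of_ended hm).trans hb
        · exact absurd hn (h' n).1
    · rw [realResult_of_not_terminates h]
      constructor
      · exact fun hb => .inr fun n => ⟨fun hn => h ⟨n, hn⟩, hb⟩
      · rintro (⟨m, hm, -⟩ | h')
        · exact absurd ⟨m, hm⟩ h
        · exact (h' 0).2
  rw [this]
  exact (MeasurableSet.iUnion fun n => hd n _).union (MeasurableSet.iInter fun n => hd n _)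

/-! ### Dictionaries -/

namespace Dict

/-- A strictly sorted list is determined by its members. This history independence is what makes
real and ideal datasets equal as states, and not merely in content. -/
theorem ext_mem {d d' : Dict} (h : ∀ a, a ∈ d.1 ↔ a ∈ d'.1) : d = d' := by
  have nodup : ∀ d : Dict, d.1.Nodup := fun d =>
    List.Pairwise.imp (fun {a b} hab => ne_of_apply_ne Prod.fst (ne_of_lt hab)) d.2
  exact Subtype.ext (List.Perm.eq_of_pairwise
    (fun a b _ _ hab hba => absurd (hab.trans hba) (lt_irrefl _)) d.2 d'.2
    ((List.perm_ext_iff_of_nodup (nodup d) (nodup d')).2 h))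

theorem mem_erase {d : Dict} {k : Str} {a : Str × Val} :
    a ∈ (d.erase k).1 ↔ a ∈ d.1 ∧ a.1 ≠ k := by
  simp [erase, List.mem_filter]

theorem mem_set {d : Dict} {k : Str} {v : Val} {a : Str × Val} :
    a ∈ (d.set k v).1 ↔ a = (k, v) ∨ a ∈ d.1 ∧ a.1 ≠ k := by
  simp only [set, List.mem_append, List.mem_cons, List.mem_filter, decide_eq_true_eq,
    ne_iff_lt_or_gt]
  tauto

theorem lookup_erase {d : Dict} {k j : Str} (h : j ≠ k) :
    (d.erase k).lookup j = d.lookup j := by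
  obtain ⟨l, hl⟩ := d
  simp only [lookup, erase]
  clear hl
  induction l with
  | nil => rfl
  | cons a l ih =>
    obtain ⟨i, v⟩ := a
    rw [List.filter_cons, List.lookup_cons]
    by_cases hi : i = k
    · have hj : (j == i) = false := by simpa [hi] using h
      rw [if_neg (by simpa using hi), hj]
      exact ih
    · rw [if_pos (by simpa using hi), List.lookup_cons, ih]

theorem neighbors_erase (d : Dict) (k : Str) : d.Neighbors (d.erase k) :=
  ⟨k, fun _ hj => (lookup_erase hj).symm⟩

theorem erase_erase (d : Dict) (k : Str) : (d.erase k).erase k = d.erase k :=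
  ext_mem fun a => by simp only [mem_erase]; tauto

/-- With `erase_update_of_ne`, this keeps the environment's view of the data equal to `d.erase y`
throughout the real execution. -/
theorem erase_update_self (d : Dict) (k : Str) (m : Msg) :
    (d.update ⟨k, m⟩).erase k = d.erase k := by
  refine ext_mem fun a => ?_
  cases m <;> simp only [update, mem_erase, mem_set]
  case delete => tauto
  all_goals
    constructor
    · rintro ⟨rfl | h, h'⟩
      · exact absurd rfl h'
      · exact h
    · exact fun h => ⟨.inr h, h.2⟩

theorem erase_update_of_ne (d : Dict) {q : Query} {k : Str} (h : q.cid ≠ k) :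
    (d.update q).erase k = (d.erase k).update q := by
  obtain ⟨c, m⟩ := q
  refine ext_mem fun a => ?_
  cases m <;> simp only [update, mem_erase, mem_set]
  case delete => tauto
  all_goals
    constructor
    · tauto
    · rintro (rfl | h')
      · exact ⟨.inl rfl, h⟩
      · tauto

end Dict

/-! ### Executions with the batch controller -/

/-- The dataset on which the batch controller trains or will train, and whether it has done so,
after a further query. -/
def ingest (s : Dict × Bool) (q : Query) : Dict × Bool :=
  match s.2, q.msg with
  | true, _ => s
  | false, .tick => (s.1, true)
  | false, _ => (s.1.update q, false)

theorem ingest_true (d : Dict) (q : Query) : ingest (d, true) q = (d, true) := rfl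

theorem ingest_tick (d : Dict) (k : Str) : ingest (d, false) ⟨k, .tick⟩ = (d, true) := rfl

theorem ingest_of_ne_tick (d : Dict) {q : Query} (h : q.msg ≠ .tick) :
    ingest (d, false) q = (d.update q, false) := by
  obtain ⟨c, m⟩ := q
  cases m <;> first | rfl | exact absurd rfl h

/-- The dataset that a list of queries produces, and whether one of them was a `tick`. -/
def ingestAll (qs : List Query) : Dict × Bool := qs.foldl ingest (Dict.empty, false)

theorem ingestAll_append (qs : List Query) (q : Query) :
    ingestAll (qs ++ [q]) = ingest (ingestAll qs) q := by
  simp [ingestAll]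

variable {M : Mechanism}

theorem dropTape_zero (r : Tape) : dropTape 0 r = r := by
  funext i
  simp [dropTape]

theorem batch_act_trained (d : Dict) (z : Str) (q : Query) (r : Tape) :
    (batchController M).act (d, some z) q r = ((d, some z), some z, 0) := rfl

theorem batch_act_tick (d : Dict) (k : Str) (r : Tape) :
    (batchController M).act (d, none) ⟨k, .tick⟩ r =
      ((Dict.empty, some (M.train d r)), some (M.train d r), ⊤) := rfl

theorem batch_act_of_ne_tick (d : Dict) {q : Query} (h : q.msg ≠ .tick) (r : Tape) :
    (batchController M).act (d, none) q r = ((d.update q, none), none, 0) := by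
  obtain ⟨c, m⟩ := q
  cases m <;> first | rfl | exact absurd rfl h

theorem replay_trained (d : Dict) (z : Str) (r : Tape) (qs : List Query) :
    replay (batchController M) (d, some z) r qs = (d, some z) := by
  induction qs generalizing r with
  | nil => rfl
  | cons q qs ih => exact ih _

theorem foldl_ingest_true (d : Dict) (qs : List Query) :
    qs.foldl ingest (d, true) = (d, true) := by
  induction qs with
  | nil => rfl
  | cons q qs ih => exact ih

/-- Nothing is read from the tape before the first `tick`, so training sees all of `r`; afterwards
the state is frozen. -/
theorem replay_untrained (d : Dict) (r : Tape) (qs : List Query) :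
    replay (batchController M) (d, none) r qs =
      if (qs.foldl ingest (d, false)).2 then
        (Dict.empty, some (M.train (qs.foldl ingest (d, false)).1 r))
      else ((qs.foldl ingest (d, false)).1, none) := by
  induction qs generalizing d with
  | nil => rfl
  | cons q qs ih =>
    rw [List.foldl_cons]
    change replay _ ((batchController M).act (d, none) q r).1
      (dropTape ((batchController M).act (d, none) q r).2.2 r) qs = _
    by_cases h : q.msg = .tick
    · obtain ⟨k, m⟩ := q
      obtain rfl : m = .tick := h
      rw [batch_act_tick, replay_trained, ingest_tick, foldl_ingest_true]
      rfl
    · rw [batch_act_of_ne_tick d h, ingest_of_ne_tick d h, dropTape_zero]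
      exact ih _

theorem idealState_batch (r : Tape) (qs : List Query) :
    idealState (batchController M) qs r =
      if (ingestAll qs).2 then (Dict.empty, some (M.train (ingestAll qs).1 r))
      else ((ingestAll qs).1, none) :=
  replay_untrained _ _ _

/-- The snapshot `c` with its tape replaced. -/
def Config.withTape {C : Controller} (c : Config C) (R : Tape) : Config C := { c with tape := R }

/-- The batch controller has not been trained; its data apart from the record of the data subject
are those that the environment has provided, and this record is gone at the end. -/
def Untrained (y : Str) (c : Config (batchController M)) : Prop :=
  ∃ d, c.state = (d, none) ∧ ingestAll c.envQueries = (d.erase y, false) ∧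
    (c.ended = true → d.erase y = d)

/-- The batch controller has been trained on `d` with the tape `R`. -/
def Trained (y : Str) (d : Dict) (R : Tape) (c : Config (batchController M)) : Prop :=
  c.state = (Dict.empty, some (M.train d R)) ∧ ingestAll c.envQueries = (d.erase y, true)

/-- Later queries may lengthen `envQueries`, but both the controller and `ingest` ignore everything
after the first `tick`. -/
theorem Trained.realStep {y : Str} {d : Dict} {R : Tape} {c : Config (batchController M)}
    (h : Trained y d R c) (E Y : Party) (rE rY : Tape) :
    Trained y d R (realStep (batchController M) E Y y rE rY c) := by
  have hq : ∀ q, (c.query q).state = c.state := by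
    intro q
    simp only [Config.query, h.1, batch_act_trained]
    rfl
  have hq' : ∀ q, Trained y d R (c.query q) := fun q => ⟨(hq q).trans h.1, h.2⟩
  unfold DelControl.realStep
  split_ifs
  · exact h
  · split
    · split_ifs
      · exact h
      · exact hq' _
      · exact hq' _
    · exact h
    · exact h
  · split
    · split_ifs
      · exact h
      · refine ⟨(hq _).trans h.1, ?_⟩
        simp only [Config.toEnv, ingestAll_append, h.2, ingest_true]
    · exact h
    · exact h

-- The point is the order of quantifiers: `c'` and `d` are chosen before `R`. Only a `tick` of the
-- environment makes the controller read its tape, and this is the second alternative.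
open Classical in
theorem Untrained.realStep {y : Str} {c : Config (batchController M)} (h : Untrained y c)
    (E Y : Party) (rE rY : Tape) :
    (∃ c', Untrained y c' ∧
      ∀ R, realStep (batchController M) E Y y rE rY (c.withTape R) = c'.withTape R) ∨
    ∃ d, ∀ R, Trained y d R (realStep (batchController M) E Y y rE rY (c.withTape R)) := by
  obtain ⟨d, hs, hd, he⟩ := h
  have hq : ∀ q : Query, q.msg ≠ .tick → ∀ R,
      (c.withTape R).query q =
        ({ c with state := (d.update q, none) } : Config (batchController M)).withTape R := by
    intro q hm R
    have := batch_act_of_ne_tick (M := M) d hm R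
    simp only [Config.query, Config.withTape, hs, this, dropTape_zero]
  have ha : ∀ q : Query, q.msg ≠ .tick → ∀ R, (c.withTape R).answer q = none := by
    intro q hm R
    have := batch_act_of_ne_tick (M := M) d hm R
    simp only [Config.answer, Config.withTape, hs, this]
  by_cases hended : c.ended = true
  · refine .inl ⟨c, ⟨d, hs, hd, he⟩, fun R => ?_⟩
    rw [DelControl.realStep, if_pos (show (c.withTape R).ended = true from hended)]
  -- Activations without a query to the controller; the clause about `ended` is vacuous here.
  have idle : ∀ c' : Config (batchController M), c'.state = c.state →
      c'.envQueries = c.envQueries → c'.ended = c.ended → Untrained y c' := by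
    intro c' h1 h2 h3
    exact ⟨d, h1.trans hs, h2 ▸ hd, fun h => absurd (h3 ▸ h) hended⟩
  by_cases hact : c.subjActive = true
  · have hstep : ∀ R, DelControl.realStep (batchController M) E Y y rE rY (c.withTape R) =
        match Y.act rY c.subjView with
        | .toController cid m =>
            if cid ≠ y ∨ m = .tick then (c.withTape R).toSubj .fail
            else if m = .delete then { (c.withTape R).query (.mk y m) with ended := true }
            else ((c.withTape R).query (.mk y m)).toSubj
              (.fromController y ((c.withTape R).answer (.mk y m)))
        | .toPeer m => (c.withTape R).toEnv (.fromPeer m)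
        | .halt => (c.withTape R).toEnv .wake := by
      intro R
      rw [DelControl.realStep, if_neg (show ¬ (c.withTape R).ended = true from hended),
        if_pos (show (c.withTape R).subjActive = true from hact)]
      rfl
    simp only [hstep]
    clear hstep
    -- The data subject cannot send `tick`, so its activations never cause training.
    left
    split
    next cid m _ =>
      by_cases h1 : cid ≠ y ∨ m = .tick
      · simp only [if_pos h1]
        exact ⟨c.toSubj .fail, idle _ rfl rfl rfl, fun R => rfl⟩
      · simp only [if_neg h1]
        have hm : m ≠ .tick := fun h => h1 (.inr h)
        have hu := d.erase_update_self y m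
        simp only [hq ⟨y, m⟩ hm, ha ⟨y, m⟩ hm]
        by_cases h2 : m = .delete
        · simp only [if_pos h2]
          refine ⟨{ c with state := (d.update ⟨y, m⟩, none), ended := true },
            ⟨d.update ⟨y, m⟩, rfl, hd.trans (by rw [hu]), fun _ => ?_⟩, fun R => rfl⟩
          subst h2
          exact d.erase_erase y
        · simp only [if_neg h2]
          exact ⟨Config.toSubj { c with state := (d.update ⟨y, m⟩, none) } _,
            ⟨d.update ⟨y, m⟩, rfl, hd.trans (by rw [hu]), fun h => absurd h hended⟩,
            fun R => rfl⟩
    · exact ⟨c.toEnv _, idle _ rfl rfl rfl, fun R => rfl⟩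
    · exact ⟨c.toEnv _, idle _ rfl rfl rfl, fun R => rfl⟩
  · have hstep : ∀ R, DelControl.realStep (batchController M) E Y y rE rY (c.withTape R) =
        match E.act rE c.envView with
        | .toController cid m =>
            if cid = y then (c.withTape R).toEnv .fail
            else
              Config.toEnv { (c.withTape R).query ⟨cid, m⟩ with
                  envQueries := c.envQueries ++ [⟨cid, m⟩] }
                (.fromController cid ((c.withTape R).answer ⟨cid, m⟩))
        | .toPeer m => (c.withTape R).toSubj (.fromPeer m)
        | .halt => (c.withTape R).toEnv .wake := by
      intro R
      rw [DelControl.realStep, if_neg (show ¬ (c.withTape R).ended = true from hended),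
        if_neg (show ¬ (c.withTape R).subjActive = true from hact)]
      rfl
    simp only [hstep]
    clear hstep
    split
    next cid m _ =>
      by_cases h1 : cid = y
      · simp only [if_pos h1]
        exact .inl ⟨c.toEnv .fail, idle _ rfl rfl rfl, fun R => rfl⟩
      · simp only [if_neg h1]
        by_cases hm : m = .tick
        · refine .inr ⟨d, fun R => ⟨?_, ?_⟩⟩
          · subst hm
            have := batch_act_tick (M := M) d cid R
            simp only [Config.toEnv, Config.query, Config.withTape, hs, this]
            rfl
          · simp only [Config.toEnv, ingestAll_append, hd, hm, ingest_tick]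
        · left
          simp only [hq ⟨cid, m⟩ hm, ha ⟨cid, m⟩ hm]
          refine ⟨Config.toEnv { c with
              state := (d.update ⟨cid, m⟩, none), envQueries := c.envQueries ++ [⟨cid, m⟩] } _,
            ⟨d.update ⟨cid, m⟩, rfl, ?_, fun h => absurd h hended⟩, fun R => rfl⟩
          simp only [Config.toEnv, ingestAll_append, hd]
          rw [ingest_of_ne_tick _ hm, Dict.erase_update_of_ne d h1]
    · exact .inl ⟨c.toSubj _, idle _ rfl rfl rfl, fun R => rfl⟩
    · exact .inl ⟨c.toEnv _, idle _ rfl rfl rfl, fun R => rfl⟩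

theorem Trained.realConfig_of_le {E Y : Party} {y : Str} {rE rY R : Tape} {d : Dict} {n m : ℕ}
    (h : Trained y d R (realConfig (batchController M) E Y y rE rY R n)) (hnm : n ≤ m) :
    Trained y d R (realConfig (batchController M) E Y y rE rY R m) := by
  induction m, hnm using Nat.le_induction with
  | base => exact h
  | succ m _ ih =>
    rw [realConfig_succ]
    exact ih.realStep E Y rE rY

/-- With the coins of the environment and the data subject fixed, either the batch controller is
never trained or it is trained on a dataset that does not depend on its coins. -/
theorem untrained_or_trained (M : Mechanism) (E Y : Party) (y : Str) (rE rY : Tape) :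
    (∀ R n, Untrained y (realConfig (batchController M) E Y y rE rY R n)) ∨
    ∃ d, ∀ R n, (realConfig (batchController M) E Y y rE rY R n).ended = true →
      Trained y d R (realConfig (batchController M) E Y y rE rY R n) := by
  classical
  -- After `n` activations the controller is untrained and the snapshot depends on `R` only through
  -- its unread tape. The first failure of this, if any, is the training step.
  let pre (n : ℕ) : Prop := ∃ c, Untrained y c ∧
    ∀ R, realConfig (batchController M) E Y y rE rY R n = c.withTape R
  by_cases hpre : ∀ n, pre n
  · left
    intro R n
    obtain ⟨c, hc, hR⟩ := hpre n
    rw [hR]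
    exact hc
  · right
    push Not at hpre
    obtain ⟨n, hn, hlt⟩ : ∃ n, ¬ pre n ∧ ∀ m < n, pre m :=
      ⟨Nat.find hpre, Nat.find_spec hpre, fun m hm => not_not.1 (Nat.find_min hpre hm)⟩
    obtain _ | n := n
    · refine absurd ⟨realInit _ fun _ => false, ⟨Dict.empty, rfl, rfl, fun _ => rfl⟩, ?_⟩ hn
      exact fun R => rfl
    obtain ⟨c, hc, hR⟩ := hlt n n.lt_succ_self
    rcases hc.realStep E Y rE rY with ⟨c', hc', hstep⟩ | ⟨d, hd⟩
    · exact absurd ⟨c', hc', fun R => by rw [realConfig_succ, hR, hstep]⟩ hn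
    have key : ∀ R, Trained y d R (realConfig (batchController M) E Y y rE rY R (n + 1)) := by
      intro R
      rw [realConfig_succ, hR]
      exact hd R
    refine ⟨d, fun R m hm => ?_⟩
    rcases le_or_gt (n + 1) m with h | h
    · exact (key R).realConfig_of_le h
    -- An execution that has ended by time `m` has the same snapshot at time `n + 1`, to which `key`
    -- applies.
    · obtain ⟨k, hk⟩ := Nat.exists_eq_add_of_le h.le
      have := key R
      rwa [hk, realConfig_add_of_ended hm] at this

/-! ### Indistinguishability, simulation and privacy -/

instance instIsProbabilityMeasureUniformTape : IsProbabilityMeasure uniformTape := by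
  unfold uniformTape
  infer_instance

instance instIsProbabilityMeasureCoinsLaw : IsProbabilityMeasure coinsLaw :=
  inferInstanceAs (IsProbabilityMeasure (uniformTape.prod (uniformTape.prod uniformTape)))

/-- Layer-cake formula: apply the hypothesis to the level sets of `f` and integrate over the level.
As `f ≤ 1`, only levels in `(0, 1)` count, so the additive error `d` is paid exactly once. For `f z
= κ z B` this is closure under randomized post-processing. -/
theorem lintegral_le_of_forall_measure_le {α : Type*} [MeasurableSpace α] {P Q : Measure α}
    {c d : ENNReal} (h : ∀ A, MeasurableSet A → P A ≤ c * Q A + d) {f : α → ENNReal}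
    (hf : Measurable f) (hf1 : ∀ a, f a ≤ 1) : ∫⁻ a, f a ∂P ≤ c * (∫⁻ a, f a ∂Q) + d := by
  have hlayer : ∀ μ : Measure α,
      ∫⁻ a, f a ∂μ = ∫⁻ t in Set.Ioi (0 : ℝ), μ {a | t < (f a).toReal} := by
    intro μ
    rw [← lintegral_eq_lintegral_meas_lt μ (Filter.Eventually.of_forall fun _ =>
      ENNReal.toReal_nonneg) hf.ennreal_toReal.aemeasurable]
    exact lintegral_congr fun a =>
      (ENNReal.ofReal_toReal (ne_top_of_le_ne_top ENNReal.one_ne_top (hf1 a))).symm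
  have hmeas : Measurable fun t : ℝ => Q {a | t < (f a).toReal} :=
    Antitone.measurable fun s t hst => measure_mono fun a (ha : t < _) => hst.trans_lt ha
  rw [hlayer P, hlayer Q]
  calc ∫⁻ t in Set.Ioi (0 : ℝ), P {a | t < (f a).toReal}
      ≤ ∫⁻ t in Set.Ioi (0 : ℝ), (c * Q {a | t < (f a).toReal} +
          (Set.Iio (1 : ℝ)).indicator (fun _ => d) t) := by
        refine lintegral_mono fun t => ?_
        by_cases ht : t < 1
        · rw [Set.indicator_of_mem (Set.mem_Iio.2 ht)]
          exact h _ (measurableSet_lt measurable_const hf.ennreal_toReal)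
        -- Levels from 1 on have empty level sets and incur no additive error.
        · have : {a | t < (f a).toReal} = ∅ := by
            refine Set.eq_empty_of_forall_notMem fun a ha => ht (lt_of_lt_of_le ha ?_)
            exact ENNReal.toReal_le_of_le_ofReal zero_le_one (by simpa using hf1 a)
          rw [this]
          simp
    _ = c * (∫⁻ t in Set.Ioi (0 : ℝ), Q {a | t < (f a).toReal}) + d := by
        rw [lintegral_add_left (hmeas.const_mul c), lintegral_const_mul c hmeas,
          lintegral_indicator_const measurableSet_Iio, Measure.restrict_apply measurableSet_Iio,
          Set.inter_comm, Set.Ioi_inter_Iio]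
        simp

theorem Indist.lintegral_left {α : Type*} [MeasurableSpace α] {ε δ : ℝ} {P Q : Measure α}
    (h : Indist ε δ P Q) {f : α → ENNReal} (hf : Measurable f) (hf1 : ∀ a, f a ≤ 1) :
    ∫⁻ a, f a ∂P ≤ ENNReal.ofReal (Real.exp ε) * (∫⁻ a, f a ∂Q) + ENNReal.ofReal δ :=
  lintegral_le_of_forall_measure_le (fun A hA => (h A hA).1) hf hf1

theorem Indist.lintegral_right {α : Type*} [MeasurableSpace α] {ε δ : ℝ} {P Q : Measure α}
    (h : Indist ε δ P Q) {f : α → ENNReal} (hf : Measurable f) (hf1 : ∀ a, f a ≤ 1) :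
    ∫⁻ a, f a ∂Q ≤ ENNReal.ofReal (Real.exp ε) * (∫⁻ a, f a ∂P) + ENNReal.ofReal δ :=
  lintegral_le_of_forall_measure_le (fun A hA => (h A hA).2) hf hf1

theorem indist_rfl {α : Type*} [MeasurableSpace α] {ε : ℝ} (hε : 0 ≤ ε) (δ : ℝ) (P : Measure α) :
    Indist ε δ P P := by
  have : ∀ x : ENNReal, x ≤ ENNReal.ofReal (Real.exp ε) * x + ENNReal.ofReal δ := fun x =>
    le_add_right (le_mul_of_one_le_left' (by simpa using hε))
  exact fun A _ => ⟨this _, this _⟩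

/-! ### Resampling the tape given the model -/

open Classical in
/-- The uniform distribution on tapes conditioned on the event that training on `d` with this tape
yields the model `z`, if this event has positive probability. -/
def Mechanism.posterior (M : Mechanism) (d : Dict) (z : Str) : Measure Tape :=
  if uniformTape (M.train d ⁻¹' {z}) = 0 then uniformTape
  else ProbabilityTheory.cond uniformTape (M.train d ⁻¹' {z})

instance Mechanism.isProbabilityMeasure_posterior (M : Mechanism) (d : Dict) (z : Str) :
    IsProbabilityMeasure (M.posterior d z) := by
  unfold posterior
  split_ifs with h
  · infer_instance
  · exact cond_isProbabilityMeasure h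

theorem Mechanism.measurableSet_train (M : Mechanism) (d : Dict) (s : Set Str) :
    MeasurableSet (M.train d ⁻¹' s) := M.measurable_train d trivial

/-- For models of probability zero both sides vanish, so the default value of the posterior is
harmless. -/
theorem Mechanism.posterior_mul (M : Mechanism) (d : Dict) (z : Str) (B : Set Tape) :
    M.posterior d z B * uniformTape (M.train d ⁻¹' {z}) =
      uniformTape (B ∩ M.train d ⁻¹' {z}) := by
  unfold posterior
  split_ifs with h
  · rw [h, mul_zero, measure_mono_null Set.inter_subset_right h]
  · rw [cond_apply (M.measurableSet_train d _), mul_comm, ← mul_assoc,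
      ENNReal.mul_inv_cancel h (measure_ne_top _ _), one_mul, Set.inter_comm]

theorem Mechanism.posterior_train (M : Mechanism) (d : Dict) {z : Str}
    (h : uniformTape (M.train d ⁻¹' {z}) ≠ 0) : M.posterior d z (M.train d ⁻¹' {z}) = 1 := by
  rw [posterior, if_neg h]
  rw [cond_apply (M.measurableSet_train d _), Set.inter_self,
    ENNReal.inv_mul_cancel h (measure_ne_top _ _)]

/-- Law of total probability: the preimages of the countably many models partition the tapes. -/
theorem Mechanism.lintegral_posterior (M : Mechanism) (d : Dict) (B : Set Tape) :
    ∫⁻ z, M.posterior d z B ∂(uniformTape.map (M.train d)) = uniformTape B := by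
  rw [lintegral_countable']
  have : ∀ z, M.posterior d z B * uniformTape.map (M.train d) {z} =
      uniformTape.restrict B (M.train d ⁻¹' {z}) := by
    intro z
    rw [Measure.map_apply (M.measurable_train d) trivial, M.posterior_mul,
      Measure.restrict_apply (M.measurableSet_train d _), Set.inter_comm]
  simp_rw [this]
  rw [← tsum_univ fun z => uniformTape.restrict B (M.train d ⁻¹' {z}),
    tsum_measure_preimage_singleton Set.countable_univ fun z _ => M.measurableSet_train d _]
  simp

theorem Mechanism.lintegral_posterior_train (M : Mechanism) (d d' : Dict) (B : Set Tape) :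
    ∫⁻ R, M.posterior d' (M.train d R) B ∂uniformTape =
      ∫⁻ z, M.posterior d' z B ∂(uniformTape.map (M.train d)) :=
  (lintegral_map (f := fun z => M.posterior d' z B) measurable_from_top (M.measurable_train d)).symm

/-- Resampling fails only on the set `N` of models that are impossible for `d'`. As `N` is null for
`d'`, the multiplicative term of the privacy bound vanishes and only `δ` remains. -/
theorem Mechanism.IsDP.le_lintegral_posterior {M : Mechanism} {ε δ : ℝ} (hM : M.IsDP ε δ)
    {d d' : Dict} (h : d.Neighbors d') (hδ : 0 ≤ δ) :
    ENNReal.ofReal (1 - δ) ≤ ∫⁻ R, M.posterior d' (M.train d R)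
      (M.train d' ⁻¹' {M.train d R}) ∂uniformTape := by
  let N : Set Str := {z | uniformTape (M.train d' ⁻¹' {z}) = 0}
  have hN' : uniformTape.map (M.train d') N = 0 := by
    rw [← Set.biUnion_of_singleton N, measure_biUnion_null_iff (Set.to_countable N)]
    intro z hz
    rw [Measure.map_apply (M.measurable_train d') trivial]
    exact hz
  have hN : uniformTape (M.train d ⁻¹' N) ≤ ENNReal.ofReal δ := by
    have := (hM d d' h N trivial).1
    rwa [hN', mul_zero, zero_add, Measure.map_apply (M.measurable_train d) trivial] at this
  calc ENNReal.ofReal (1 - δ) = 1 - ENNReal.ofReal δ := by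
        rw [ENNReal.ofReal_sub _ hδ, ENNReal.ofReal_one]
    _ ≤ 1 - uniformTape (M.train d ⁻¹' N) := tsub_le_tsub_left hN _
    _ = uniformTape (M.train d ⁻¹' N)ᶜ :=
        (prob_compl_eq_one_sub (M.measurableSet_train d N)).symm
    _ = ∫⁻ R, (M.train d ⁻¹' N)ᶜ.indicator 1 R ∂uniformTape :=
        (lintegral_indicator_one (M.measurableSet_train d N).compl).symm
    _ ≤ _ := by
        refine lintegral_mono fun R => ?_
        by_cases hR : R ∈ (M.train d ⁻¹' N)ᶜ
        · rw [Set.indicator_of_mem hR, M.posterior_train d' hR]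
          rfl
        · rw [Set.indicator_of_notMem hR]
          exact zero_le

/-! ### The simulator -/

/-- The joint law of coins and simulated randomness is the product of the law of the coins with the
kernel that the simulator induces. -/
theorem exists_experiment_eq_compProd (C : Controller) (S : Simulator C) (E Y : Party) (y : Str) :
    ∃ κ : Kernel Coins Tape, IsMarkovKernel κ ∧
      (∀ ω, κ ω = S.sample (realResult C E Y y ω.1 ω.2.1 ω.2.2).1
        (realResult C E Y y ω.1 ω.2.1 ω.2.2).2 ω.2.2) ∧
      experiment C S E Y y = coinsLaw ⊗ₘ κ := by
  let κ : Kernel Coins Tape :=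
    ⟨fun ω => S.sample (realResult C E Y y ω.1 ω.2.1 ω.2.2).1
        (realResult C E Y y ω.1 ω.2.1 ω.2.2).2 ω.2.2,
      measurable_dispatch (g := fun ω : Coins => realResult C E Y y ω.1 ω.2.1 ω.2.2)
        (F := fun b (ω : Coins) => S.sample b.1 b.2 ω.2.2)
        (measurableSet_realResult C E Y y)
        fun b => (S.sample b.1 b.2).measurable.comp measurable_snd.snd⟩
  have hκ : IsMarkovKernel κ := ⟨fun ω => (S.markov _ _).isProbabilityMeasure _⟩
  refine ⟨κ, hκ, fun _ => rfl, ?_⟩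
  rw [Measure.compProd_eq_comp_prod]
  refine congrArg coinsLaw.bind (funext fun ω => ?_)
  rw [Kernel.prod_apply, Kernel.id_apply, Measure.dirac_prod]
  rfl

/-- Puts the integral over the controller's tape innermost, so that the other coins can be held
fixed. -/
theorem lintegral_coinsLaw {f : Coins → ENNReal} (hf : Measurable f) :
    ∫⁻ ω, f ω ∂coinsLaw =
      ∫⁻ p, ∫⁻ R, f (p.1, p.2, R) ∂uniformTape ∂(uniformTape.prod uniformTape) := by
  have h := measurePreserving_prodAssoc uniformTape uniformTape uniformTape
  rw [coinsLaw, ← h.lintegral_comp hf]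
  refine (lintegral_prod _ (hf.comp MeasurableEquiv.prodAssoc.measurable).aemeasurable).trans ?_
  rfl

/-- If the model has been published, the simulator samples a tape that yields it on the data of
the environment alone; otherwise, it keeps the tape. -/
def batchSimulator (M : Mechanism) : Simulator (batchController M) where
  sample qs s :=
    match s with
    | some (_, some z) => Kernel.const Tape (M.posterior (ingestAll qs).1 z)
    | _ => Kernel.id
  markov qs s := by
    rcases s with _ | ⟨d, _ | z⟩
    · exact inferInstanceAs (IsMarkovKernel Kernel.id)
    · exact inferInstanceAs (IsMarkovKernel Kernel.id)
    · exact inferInstanceAs (IsMarkovKernel (Kernel.const Tape _))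

/-- The event that the ideal state equals the real one, unless the latter is `⊥`, as an event
about the simulated tape. -/
def Faithful (C : Controller) (r : List Query × Option C.State) : Set Tape :=
  {R' | r.2 = some (idealState C r.1 R') ∨ r.2 = none}

/-- What the simulator does once the coins of the environment and the data subject are fixed:
either it keeps the controller's tape, which is right, or it resamples it after training. -/
theorem simulation_cases (M : Mechanism) {E Y : Party} {y : Str} {rE rY : Tape}
    (h : (∀ᵐ R ∂uniformTape, Terminates (batchController M) E Y y rE rY R) ∨
      ∀ᵐ R ∂uniformTape, ¬ Terminates (batchController M) E Y y rE rY R) :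
    (∀ᵐ R ∂uniformTape,
      (batchSimulator M).sample (realResult (batchController M) E Y y rE rY R).1
        (realResult (batchController M) E Y y rE rY R).2 R = Measure.dirac R ∧
      R ∈ Faithful _ (realResult (batchController M) E Y y rE rY R)) ∨
    ∃ d : Dict, ∀ᵐ R ∂uniformTape,
      (batchSimulator M).sample (realResult (batchController M) E Y y rE rY R).1
        (realResult (batchController M) E Y y rE rY R).2 R =
          M.posterior (d.erase y) (M.train d R) ∧
      M.train (d.erase y) ⁻¹' {M.train d R} ⊆
        Faithful _ (realResult (batchController M) E Y y rE rY R) := by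
  have hnot : ∀ R, ¬ Terminates (batchController M) E Y y rE rY R →
      (batchSimulator M).sample (realResult (batchController M) E Y y rE rY R).1
        (realResult (batchController M) E Y y rE rY R).2 R = Measure.dirac R ∧
      R ∈ Faithful _ (realResult (batchController M) E Y y rE rY R) := by
    intro R hR
    rw [realResult_of_not_terminates hR]
    exact ⟨Kernel.id_apply R, .inr rfl⟩
  rcases h with h | h
  · rcases untrained_or_trained M E Y y rE rY with hu | ⟨d, hd⟩
    · left
      filter_upwards [h] with R hR
      obtain ⟨n, hn⟩ := hR
      obtain ⟨d, hs, hq, he⟩ := hu R n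
      rw [realResult_of_ended hn, hs]
      refine ⟨Kernel.id_apply R, .inl ?_⟩
      -- The execution has ended, so the record of `y` has been deleted and `d.erase y = d`.
      simp only [idealState_batch, hq, he hn]
      rfl
    · right
      refine ⟨d, ?_⟩
      filter_upwards [h] with R hR
      obtain ⟨n, hn⟩ := hR
      obtain ⟨hs, hq⟩ := hd R n hn
      rw [realResult_of_ended hn, hs]
      refine ⟨?_, fun R' hR' => .inl ?_⟩
      · simp only [batchSimulator, hq, Kernel.const_apply]
      · have hR' : M.train (d.erase y) R' = M.train d R := hR'
        simp only [idealState_batch, hq, hR']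
        rfl
  · left
    filter_upwards [h] with R hR using hnot R hR

theorem Mechanism.IsDP.indist_simulated {M : Mechanism} {ε δ : ℝ} (hM : M.IsDP ε δ)
    (hε : 0 ≤ ε) {E Y : Party} {y : Str} {rE rY : Tape}
    (h : (∀ᵐ R ∂uniformTape, Terminates (batchController M) E Y y rE rY R) ∨
      ∀ᵐ R ∂uniformTape, ¬ Terminates (batchController M) E Y y rE rY R)
    {B : Set Tape} (hB : MeasurableSet B) :
    let μ := fun R => (batchSimulator M).sample
      (realResult (batchController M) E Y y rE rY R).1
      (realResult (batchController M) E Y y rE rY R).2 R B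
    ∫⁻ R, μ R ∂uniformTape ≤
        ENNReal.ofReal (Real.exp ε) * uniformTape B + ENNReal.ofReal δ ∧
      uniformTape B ≤
        ENNReal.ofReal (Real.exp ε) * (∫⁻ R, μ R ∂uniformTape) + ENNReal.ofReal δ := by
  intro μ
  rcases simulation_cases M h with h | ⟨d, h⟩
  · have : ∫⁻ R, μ R ∂uniformTape = uniformTape B := by
      rw [← lintegral_indicator_one hB]
      refine lintegral_congr_ae ?_
      filter_upwards [h] with R hR
      simp only [μ, hR.1, Measure.dirac_apply' _ hB]
    rw [this]
    exact indist_rfl hε δ uniformTape B hB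
  · have : ∫⁻ R, μ R ∂uniformTape =
        ∫⁻ z, M.posterior (d.erase y) z B ∂(uniformTape.map (M.train d)) := by
      rw [← M.lintegral_posterior_train]
      refine lintegral_congr_ae ?_
      filter_upwards [h] with R hR
      simp only [μ, hR.1]
    -- Both sides are now integrals of one function of the model with values in `[0, 1]`, against
    -- the laws of `M` on neighboring datasets.
    rw [this, ← M.lintegral_posterior (d.erase y) B]
    have hdp := hM d (d.erase y) (d.neighbors_erase y)
    exact ⟨hdp.lintegral_left measurable_from_top fun _ => prob_le_one,
      hdp.lintegral_right measurable_from_top fun _ => prob_le_one⟩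

theorem Mechanism.IsDP.le_lintegral_faithful {M : Mechanism} {ε δ : ℝ} (hM : M.IsDP ε δ)
    (hδ : 0 ≤ δ) {E Y : Party} {y : Str} {rE rY : Tape}
    (h : (∀ᵐ R ∂uniformTape, Terminates (batchController M) E Y y rE rY R) ∨
      ∀ᵐ R ∂uniformTape, ¬ Terminates (batchController M) E Y y rE rY R) :
    ENNReal.ofReal (1 - δ) ≤ ∫⁻ R, (batchSimulator M).sample
      (realResult (batchController M) E Y y rE rY R).1
      (realResult (batchController M) E Y y rE rY R).2 R
      (Faithful _ (realResult (batchController M) E Y y rE rY R)) ∂uniformTape := by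
  rcases simulation_cases M h with h | ⟨d, h⟩
  · calc ENNReal.ofReal (1 - δ) ≤ ∫⁻ _, 1 ∂uniformTape := by simpa using hδ
      _ ≤ _ := by
        refine lintegral_mono_ae ?_
        filter_upwards [h] with R hR
        rw [hR.1, Measure.dirac_apply_of_mem hR.2]
  · refine (hM.le_lintegral_posterior (d.neighbors_erase y) hδ).trans (lintegral_mono_ae ?_)
    filter_upwards [h] with R hR
    rw [hR.1]
    exact measure_mono hR.2

theorem measurableSet_faithful (M : Mechanism)
    (r : List Query × Option (batchController M).State) :
    MeasurableSet (Faithful (batchController M) r) := by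
  have : Measurable[_, ⊤] fun R' => idealState (batchController M) r.1 R' := by
    simp only [idealState_batch]
    split_ifs
    · exact (@measurable_from_top _ _ ⊤ fun z : Str => (Dict.empty, some z)).comp
        (M.measurable_train _)
    · exact @measurable_const _ _ ⊤ _ _
  exact (this (t := {s | r.2 = some s}) trivial).union (MeasurableSet.const _)

end DelControl

end

/-! ### Averaging over the coins of the environment and the data subject -/

open DelControl in
theorem corollary5p2 (ε δ : ℝ) (hε : 0 ≤ ε) (hδ : 0 ≤ δ) (hδ1 : δ < 1)
    (M : DelControl.Mechanism) (hM : M.IsDP ε δ) :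
    DelControl.DeletionAsControlFor ε δ (DelControl.batchController M)
      (DelControl.TerminationUnaffected (DelControl.batchController M)) := by
  refine ⟨batchSimulator M, fun y E Y hY => ?_⟩
  obtain ⟨κ, _, hκ, hexp⟩ :=
    exists_experiment_eq_compProd (batchController M) (batchSimulator M) E Y y
  rw [hexp]
  constructor
  · intro B hB
    have hint : (coinsLaw ⊗ₘ κ).map Prod.snd B =
        ∫⁻ p, ∫⁻ R, κ (p.1, p.2, R) B ∂uniformTape ∂(uniformTape.prod uniformTape) := by
      rw [Measure.map_apply measurable_snd hB, Measure.compProd_apply (measurable_snd hB),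
        ← lintegral_coinsLaw (κ.measurable_coe hB)]
      rfl
    have hmeas : Measurable fun p : Tape × Tape =>
        ∫⁻ R, κ (p.1, p.2, R) B ∂uniformTape :=
      Measurable.lintegral_prod_right' (f := fun q : (Tape × Tape) × Tape =>
        κ (q.1.1, q.1.2, q.2) B)
        ((κ.measurable_coe hB).comp MeasurableEquiv.prodAssoc.measurable)
    have hcond : ∀ᵐ p : Tape × Tape ∂(uniformTape.prod uniformTape),
        ∫⁻ R, κ (p.1, p.2, R) B ∂uniformTape ≤
            ENNReal.ofReal (Real.exp ε) * uniformTape B + ENNReal.ofReal δ ∧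
          uniformTape B ≤ ENNReal.ofReal (Real.exp ε) *
            (∫⁻ R, κ (p.1, p.2, R) B ∂uniformTape) + ENNReal.ofReal δ := by
      filter_upwards [hY] with p hp
      simp only [hκ]
      exact hM.indist_simulated hε hp hB
    rw [hint]
    -- Both bounds are affine in the conditional probability, so they survive integration over a
    -- probability measure with the same constants.
    constructor
    · refine (lintegral_mono_ae (hcond.mono fun p hp => hp.1)).trans ?_
      simp
    · calc uniformTape B = ∫⁻ _, uniformTape B ∂(uniformTape.prod uniformTape) := by simp
        _ ≤ _ := lintegral_mono_ae (hcond.mono fun p hp => hp.2)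
        _ = _ := by
          rw [lintegral_add_right _ measurable_const, lintegral_const_mul _ hmeas]
          simp
  · have hset : MeasurableSet {p : Coins × Tape | p.2 ∈ Faithful (batchController M)
        (realResult (batchController M) E Y y p.1.1 p.1.2.1 p.1.2.2)} :=
      measurableSet_dispatch (P := fun r (p : Coins × Tape) => p.2 ∈ Faithful _ r)
        (fun b => measurable_fst (measurableSet_realResult _ E Y y b))
        fun b => measurable_snd (measurableSet_faithful M b)
    -- Written as a section condition on the simulated tape, the event has its probability computed
    -- by integrating the kernel.
    change _ ≤ (coinsLaw ⊗ₘ κ) {p : Coins × Tape | p.2 ∈ Faithful (batchController M)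
      (realResult (batchController M) E Y y p.1.1 p.1.2.1 p.1.2.2)}
    rw [Measure.compProd_apply hset,
      lintegral_coinsLaw (Kernel.measurable_kernel_prodMk_left hset)]
    calc ENNReal.ofReal (1 - δ)
        = ∫⁻ _, ENNReal.ofReal (1 - δ) ∂(uniformTape.prod uniformTape) := by simp
      _ ≤ _ := by
        refine lintegral_mono_ae ?_
        filter_upwards [hY] with p hp
        simp only [hκ]
        exact hM.le_lintegral_faithful hδ hp
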